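/- Let $D\in\mathbb{N}$, let $\mathcal{X},\mathcal{Y}\subset\mathbb{R}^D$ be compact, let $c:\mathcal{X}\times\mathcal{Y}\to\mathbb{R}$ be continuous, let $w\in[1,\infty)$, let $\mathbb{P}$ be an atomless Borel probability measure on $\mathcal{X}$ (i.e. $\mathbb{P}(\{x\})=0$ for every $x\in\mathcal{X}$), and let $\mathbb{Q}$ be a Borel probability measure on $\mathcal{Y}$. Then $$\inf_{T\sharp\mathbb{P}\leq w\mathbb{Q}}\int_{\mathcal{X}}c\big(x,T(x)\big)\,d\mathbb{P}(x)=\inf_{\pi\in\Pi^{w}(\mathbb{P},\mathbb{Q})}\int_{\mathcal{X}\times\mathcal{Y}}c(x,y)\,d\pi(x,y),$$ that is, Monge's and Kantorovich's incomplete transport (IT) costs coincide. Here the first infimum is over Borel measurable maps $T:\mathcal{X}\to\mathcal{Y}$ whose push-forward $T\sharp\mathbb{P}$ satisfies $(T\sharp\mathbb{P})(A)\leq w\,\mathbb{Q}(A)$ for all Borel $A\subset\mathcal{Y}$, and $\Pi^{w}(\mathbb{P},\mathbb{Q})$ is the set of Borel probability measures $\pi$ on $\mathcal{X}\times\mathcal{Y}$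 whose first marginal is $\mathbb{P}$ and whose second marginal $\pi_y$ satisfies $\pi_y(A)\leq w\,\mathbb{Q}(A)$ for all Borel $A\subset\mathcal{Y}$. The infimum of the empty set is $+\infty$. -/

import Mathlib

open MeasureTheory
open scoped NNReal

noncomputable section

/-- The maps admissible in Monge's incomplete transport problem with parameter `w`:
measurable `T : X → Y` with `T♯P ≤ w Q` (setwise on all measurable sets). -/
def ITMaps {X Y : Type*} [MeasurableSpace X] [MeasurableSpace Y]
    (w : ℝ≥0) (P : Measure X) (Q : Measure Y) : Set (X → Y) :=
  {T | Measurable T ∧ P.map T ≤ w • Q}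

/-- The set `Π^w(P, Q)` of plans admissible in Kantorovich's incomplete transport problem:
probability measures on `X × Y` whose first marginal is `P` and whose second marginal
is at most `w Q`. -/
def ITPlans {X Y : Type*} [MeasurableSpace X] [MeasurableSpace Y]
    (w : ℝ≥0) (P : Measure X) (Q : Measure Y) : Set (Measure (X × Y)) :=
  {π | IsProbabilityMeasure π ∧ π.fst = P ∧ π.snd ≤ w • Q}

/-- Monge's incomplete transport cost, as an infimum in the extended reals
(so that the infimum over an empty set of maps is `+∞`). -/
def mongeITCost {X Y : Type*} [MeasurableSpace X] [MeasurableSpace Y]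
    (c : X × Y → ℝ) (w : ℝ≥0) (P : Measure X) (Q : Measure Y) : EReal :=
  ⨅ T ∈ ITMaps w P Q, ((∫ x, c (x, T x) ∂P : ℝ) : EReal)

/-- Kantorovich's incomplete transport cost, as an infimum in the extended reals. -/
def kantorovichITCost {X Y : Type*} [MeasurableSpace X] [MeasurableSpace Y]
    (c : X × Y → ℝ) (w : ℝ≥0) (P : Measure X) (Q : Measure Y) : EReal :=
  ⨅ π ∈ ITPlans w P Q, ((∫ z, c z ∂π : ℝ) : EReal)

end

/-!
A map `T` induces the plan `(id, T)♯P`, so Kantorovich's cost is at most Monge's.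

For the converse, fix a plan `π` and cut `X` into countably many Borel cells of small diameter, the
fibres of a measurable `f : X → ℕ`. The measures `P` and `π` give the same mass to a cell `A` and
to the strip `A × Y`. As `P` is atomless, there is a measurable map carrying `P` restricted to `A`
onto `π` restricted to `A × Y` (`exists_measurable_map_eq_of_measure_univ_eq`: the distribution
function carries `P` to the uniform law on `[0, 1]`, and any law on a standard Borel space is an
image of the latter). These maps glue to a measurable `S : X → X × Y` with `S♯P = π` such that the
first coordinate of `S x` lies in the cell of `x` for almost every `x`
(`exists_measurable_map_eq_and_comp_ae_eq`). Then `T = snd ∘ S` satisfies `T♯P = π_y ≤ w Q`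
*exactly*, and since `∫ c dπ = ∫ c(S x) dP(x)`, uniform continuity of `c` shows that the cost of `T`
differs from that of `π` by an arbitrarily small amount.
-/

open Set Filter Topology ENNReal unitInterval

section Transport

/-- The distribution function of an atomless law is continuous, as it has no jumps. -/
lemma continuous_cdf_of_nullSingletonClass (μ : Measure ℝ) [IsProbabilityMeasure μ]
    [NullSingletonClass μ] : Continuous (ProbabilityTheory.cdf μ) := by
  set F := ProbabilityTheory.cdf μ with hF
  refine continuous_iff_continuousAt.2 fun x => ?_
  rw [continuousAt_iff_continuous_left_right]
  refine ⟨?_, F.right_continuous x⟩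
  have h : F.measure {x} = 0 := by
    rw [hF, ProbabilityTheory.measure_cdf]; exact measure_singleton x
  rw [StieltjesFunction.measure_singleton, ENNReal.ofReal_eq_zero, sub_nonpos] at h
  rw [← continuousWithinAt_Iio_iff_Iic, F.mono.continuousWithinAt_Iio_iff_leftLim_eq]
  exact le_antisymm (F.mono.leftLim_le le_rfl) h

/-- Probability integral transform: the distribution function carries an atomless law to the
uniform law on `[0, 1]`. -/
lemma measure_setOf_cdf_le (μ : Measure ℝ) [IsProbabilityMeasure μ] [NullSingletonClass μ]
    {t : ℝ} (ht0 : 0 ≤ t) (ht1 : t ≤ 1) :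
    μ {x | ProbabilityTheory.cdf μ x ≤ t} = ENNReal.ofReal t := by
  have hc := continuous_cdf_of_nullSingletonClass μ
  have hsurj : ∀ s, 0 < s → s < 1 → ∃ a, ProbabilityTheory.cdf μ a = s := fun s h0 h1 => by
    obtain ⟨a, ha⟩ := ((ProbabilityTheory.tendsto_cdf_atBot μ).eventually_lt_const h0).exists
    obtain ⟨b, hb⟩ := ((ProbabilityTheory.tendsto_cdf_atTop μ).eventually_const_lt h1).exists
    exact mem_range_of_exists_le_of_exists_ge hc ⟨a, ha.le⟩ ⟨b, hb.le⟩
  rcases ht1.eq_or_lt with rfl | ht1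
  · simp [ProbabilityTheory.cdf_le_one]
  apply le_antisymm
  -- the upper bound holds for every level `r > t`, at a point `b` where the distribution function
  -- takes the value `r`
  · refine le_of_forall_gt_imp_ge_of_dense fun r hr => ?_
    rcases le_or_gt 1 r with h1 | h1
    · exact prob_le_one.trans h1
    have hrt : r ≠ ∞ := (h1.trans one_lt_top).ne
    have hr' : t < r.toReal := (ENNReal.ofReal_lt_iff_lt_toReal ht0 hrt).1 hr
    have hr1 : r.toReal < 1 := by
      simpa using (ENNReal.toReal_lt_toReal hrt one_ne_top).2 h1
    obtain ⟨b, hb⟩ := hsurj r.toReal (ht0.trans_lt hr') hr1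
    calc μ {x | ProbabilityTheory.cdf μ x ≤ t} ≤ μ (Iic b) := by
          refine measure_mono fun x hx => ?_
          by_contra hxb
          have := ProbabilityTheory.monotone_cdf μ (not_le.1 hxb).le
          have hx' : ProbabilityTheory.cdf μ x ≤ t := hx
          linarith
      _ = r := by rw [← ProbabilityTheory.ofReal_cdf, hb, ENNReal.ofReal_toReal hrt]
  · rcases ht0.eq_or_lt with rfl | ht0
    · simp
    obtain ⟨a, ha⟩ := hsurj t ht0 ht1
    rw [← ha, ProbabilityTheory.ofReal_cdf]
    exact measure_mono fun x hx => ProbabilityTheory.monotone_cdf μ hx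

lemma measure_eq_tsum_inter_preimage_singleton {W ι : Type*} [MeasurableSpace W] [Countable ι]
    [MeasurableSpace ι] [MeasurableSingletonClass ι] (μ : Measure W) {k : W → ι}
    (hk : Measurable k) (s : Set W) : μ s = ∑' n, μ (s ∩ k ⁻¹' {n}) := by
  have hm : ∀ n, MeasurableSet (k ⁻¹' {n}) := fun n => hk (measurableSet_singleton n)
  have hd : Pairwise (Function.onFun Disjoint fun n => k ⁻¹' {n}) := fun m n hmn =>
    (disjoint_singleton.2 hmn).preimage k
  calc μ s = μ.restrict s (⋃ n, k ⁻¹' {n}) := by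
        rw [← preimage_iUnion, iUnion_of_singleton, preimage_univ, Measure.restrict_apply_univ]
    _ = ∑' n, μ (s ∩ k ⁻¹' {n}) := by
        rw [measure_iUnion hd hm]
        exact tsum_congr fun n => by rw [Measure.restrict_apply (hm n), inter_comm]

variable {X Z : Type*} [MeasurableSpace X] [StandardBorelSpace X]
  [MeasurableSpace Z] [StandardBorelSpace Z]

lemma exists_measurable_map_eq_volume_unitInterval (P : Measure X) [IsProbabilityMeasure P]
    [NullSingletonClass P] : ∃ U : X → I, Measurable U ∧ P.map U = volume := by
  have he := measurableEmbedding_embeddingReal X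
  set μ := P.map (embeddingReal X) with hμ
  have : IsProbabilityMeasure μ := Measure.isProbabilityMeasure_map he.measurable.aemeasurable
  have : NullSingletonClass μ := ⟨fun x => by
    rw [hμ, he.map_apply]
    exact (subsingleton_singleton.preimage he.injective).measure_zero P⟩
  have hF : Measurable (ProbabilityTheory.cdf μ) := (ProbabilityTheory.monotone_cdf μ).measurable
  have hG : Measurable fun x : X => (⟨ProbabilityTheory.cdf μ (embeddingReal X x),
      ProbabilityTheory.cdf_nonneg μ _, ProbabilityTheory.cdf_le_one μ _⟩ : I) :=
    (hF.comp he.measurable).subtype_mk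
  refine ⟨_, hG, ?_⟩
  have := Measure.isProbabilityMeasure_map (μ := P) hG.aemeasurable
  refine Measure.ext_of_Iic _ _ fun t => ?_
  rw [Measure.map_apply hG measurableSet_Iic, unitInterval.volume_Iic,
    ← measure_setOf_cdf_le μ t.2.1 t.2.2, hμ,
    Measure.map_apply he.measurable (measurableSet_le hF measurable_const)]
  rfl

lemma exists_measurable_map_eq_of_measure_univ_eq [Nonempty Z] (P : Measure X) [IsFiniteMeasure P]
    [NullSingletonClass P] (ν : Measure Z) (h : P univ = ν univ) :
    ∃ S : X → Z, Measurable S ∧ P.map S = ν := by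
  rcases eq_or_ne P 0 with rfl | hP
  · refine ⟨fun _ => Classical.arbitrary Z, measurable_const, ?_⟩
    rw [Measure.map_zero, eq_comm, ← Measure.measure_univ_eq_zero, ← h]
    rfl
  set m := P univ with hm
  have hm0 : m ≠ 0 := by simpa [hm] using hP
  have hmt : m ≠ ∞ := measure_ne_top P univ
  have : IsProbabilityMeasure (m⁻¹ • P) := ⟨by
    simpa [← hm] using ENNReal.inv_mul_cancel hm0 hmt⟩
  have : IsProbabilityMeasure (m⁻¹ • ν) := ⟨by
    simpa [← h] using ENNReal.inv_mul_cancel hm0 hmt⟩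
  have : NullSingletonClass (m⁻¹ • P) := ⟨fun x => by simp⟩
  obtain ⟨U, hU, hUP⟩ := exists_measurable_map_eq_volume_unitInterval (m⁻¹ • P)
  obtain ⟨V, hV, hVν⟩ := (m⁻¹ • ν).exists_measurable_map_eq
  refine ⟨V ∘ U, hV.comp hU, ?_⟩
  have key : m⁻¹ • P.map (V ∘ U) = m⁻¹ • ν := by
    rw [← hVν, ← hUP, Measure.map_map hV hU, Measure.map_smul]
  have := congrArg (m • ·) key
  simpa [smul_smul, ENNReal.mul_inv_cancel hm0 hmt] using this

/-- An atomless measure can be transported to any other measure of the same mass in such a way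
that prescribed countable labels, equidistributed under the two measures, are respected. -/
lemma exists_measurable_map_eq_and_comp_ae_eq {ι : Type*} [Countable ι] [MeasurableSpace ι]
    [MeasurableSingletonClass ι] [Nonempty Z] (P : Measure X) [IsFiniteMeasure P]
    [NullSingletonClass P] (ν : Measure Z) {f : X → ι} (hf : Measurable f) {g : Z → ι}
    (hg : Measurable g) (h : P.map f = ν.map g) :
    ∃ S : X → Z, Measurable S ∧ P.map S = ν ∧ g ∘ S =ᵐ[P] f := by
  have hA : ∀ n, MeasurableSet (f ⁻¹' {n}) := fun n => hf (measurableSet_singleton n)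
  have hB : ∀ n, MeasurableSet (g ⁻¹' {n}) := fun n => hg (measurableSet_singleton n)
  have hex : ∀ n, ∃ S : X → Z, Measurable S ∧
      (P.restrict (f ⁻¹' {n})).map S = ν.restrict (g ⁻¹' {n}) := fun n => by
    apply exists_measurable_map_eq_of_measure_univ_eq
    have := congrArg (fun ρ => ρ {n}) h
    simpa [Measure.map_apply hf, Measure.map_apply hg] using this
  choose S hS hSν using hex
  have hmeas : Measurable fun x => S (f x) x :=
    measurable_from_prod_countable_right (f := fun p : ι × X => S p.1 p.2) hS |>.comp
      (hf.prodMk measurable_id)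
  have hcell : ∀ n {B : Set Z}, MeasurableSet B →
      P ((fun x => S (f x) x) ⁻¹' B ∩ f ⁻¹' {n}) = ν (B ∩ g ⁻¹' {n}) := fun n B hB' => by
    rw [← Measure.restrict_apply hB', ← hSν n, Measure.map_apply (hS n) hB',
      Measure.restrict_apply (hS n hB')]
    congr 1
    ext x
    simp only [mem_inter_iff, mem_preimage, mem_singleton_iff, and_congr_left_iff]
    rintro rfl
    rfl
  refine ⟨_, hmeas, Measure.ext fun B hB' => ?_, ?_⟩
  · rw [Measure.map_apply hmeas hB', measure_eq_tsum_inter_preimage_singleton P hf _,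
      measure_eq_tsum_inter_preimage_singleton ν hg B]
    exact tsum_congr fun n => hcell n hB'
  · have : ∀ n, ∀ᵐ x ∂P, f x = n → g (S (f x) x) = n := fun n => by
      rw [ae_iff, ← nonpos_iff_eq_zero]
      refine (measure_mono ?_).trans (hcell n (hB n).compl).le |>.trans (by simp)
      intro x hx
      simpa [and_comm] using hx
    filter_upwards [ae_all_iff.2 this] with x hx using hx _ rfl

end Transport

section Cost

/-- A separable metric space has a countable Borel partition into cells of small diameter. -/
lemma exists_measurable_nat_dist_lt (X : Type*) [PseudoMetricSpace X]
    [TopologicalSpace.SeparableSpace X] [MeasurableSpace X] [BorelSpace X] {δ : ℝ} (hδ : 0 < δ) :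
    ∃ f : X → ℕ, Measurable f ∧ ∀ x y, f x = f y → dist x y < δ := by
  rcases isEmpty_or_nonempty X with hX | hX
  · exact ⟨fun _ => 0, measurable_const, fun x => hX.elim x⟩
  classical
  have hex : ∀ x : X, ∃ n, dist x (TopologicalSpace.denseSeq X n) < δ / 2 := fun x => by
    obtain ⟨_, ⟨n, rfl⟩, hn⟩ := (Metric.dense_iff.1 (TopologicalSpace.denseRange_denseSeq X)) x
      (δ / 2) (half_pos hδ) |>.imp fun _ h => h.symm
    exact ⟨n, by rwa [dist_comm]⟩
  refine ⟨fun x => Nat.find (hex x), measurable_find hex fun k => measurableSet_ball,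
    fun x y hxy => ?_⟩
  have hx := Nat.find_spec (hex x)
  have hy := Nat.find_spec (hex y)
  have hxy' : Nat.find (hex x) = Nat.find (hex y) := hxy
  rw [hxy'] at hx
  linarith [dist_triangle_right x y (TopologicalSpace.denseSeq X (Nat.find (hex y)))]

variable {X Y : Type*} [MetricSpace X] [MeasurableSpace X] [BorelSpace X]
  [MetricSpace Y] [CompactSpace Y] [MeasurableSpace Y] [BorelSpace Y]

lemma kantorovichITCost_le_mongeITCost {c : X × Y → ℝ} (hc : Continuous c) (w : ℝ≥0)
    (P : Measure X) [IsProbabilityMeasure P] (Q : Measure Y) :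
    kantorovichITCost c w P Q ≤ mongeITCost c w P Q := by
  refine le_iInf₂ fun T hT => ?_
  have hg : Measurable fun x => (x, T x) := measurable_id.prodMk hT.1
  refine (iInf₂_le (P.map fun x => (x, T x)) ?_).trans_eq ?_
  · refine ⟨Measure.isProbabilityMeasure_map hg.aemeasurable, ?_, ?_⟩
    · rw [Measure.fst_map_prodMk hT.1, Measure.map_id']
    · rw [Measure.snd_map_prodMk measurable_id']
      exact hT.2
  · rw [integral_map hg.aemeasurable hc.aestronglyMeasurable]

variable [CompactSpace X]

/-- Every plan with an atomless first marginal `P` can be replaced by a map whose push-forward of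
`P` is exactly the second marginal of the plan, raising the transport cost by at most `ε`. -/
lemma exists_measurable_map_eq_snd_integral_le {c : X × Y → ℝ} (hc : Continuous c)
    (π : Measure (X × Y)) [IsProbabilityMeasure π] [NullSingletonClass π.fst] {ε : ℝ}
    (hε : 0 < ε) :
    ∃ T : X → Y, Measurable T ∧ π.fst.map T = π.snd ∧
      ∫ x, c (x, T x) ∂π.fst ≤ (∫ z, c z ∂π) + ε := by
  have hne : Nonempty (X × Y) := nonempty_of_isProbabilityMeasure π
  obtain ⟨δ, hδ, hcδ⟩ := Metric.uniformContinuous_iff.1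
    (CompactSpace.uniformContinuous_of_continuous hc) ε hε
  obtain ⟨f, hf, hfδ⟩ := exists_measurable_nat_dist_lt X hδ
  obtain ⟨S, hS, hSπ, hSf⟩ := exists_measurable_map_eq_and_comp_ae_eq π.fst π hf
    (hf.comp measurable_fst) (Measure.map_map hf measurable_fst)
  have hT : Measurable fun x => (S x).2 := measurable_snd.comp hS
  have hint : ∀ R : X → X × Y, Measurable R → Integrable (fun x => c (R x)) π.fst := fun R hR => by
    obtain ⟨C, hC⟩ := isCompact_univ.exists_bound_of_continuousOn hc.continuousOn
    exact .of_bound (hc.measurable.comp hR).aestronglyMeasurable C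
      (ae_of_all _ fun x => hC _ (mem_univ _))
  refine ⟨fun x => (S x).2, hT, ?_, ?_⟩
  · nth_rw 2 [← hSπ]
    rw [Measure.snd, Measure.map_map measurable_snd hS]
    rfl
  · have hcost : ∫ z, c z ∂π = ∫ x, c (S x) ∂π.fst := by
      nth_rw 1 [← hSπ]
      exact integral_map hS.aemeasurable hc.aestronglyMeasurable
    calc ∫ x, c (x, (S x).2) ∂π.fst ≤ ∫ x, (c (S x) + ε) ∂π.fst := by
          refine integral_mono_ae (hint _ (measurable_id.prodMk hT))
            ((hint S hS).add (integrable_const ε)) ?_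
          filter_upwards [hSf] with x hx
          have hd : dist (x, (S x).2) (S x) < δ := by
            rw [Prod.dist_eq]
            simpa [hδ] using hfδ _ _ hx.symm
          have := hcδ hd
          rw [Real.dist_eq] at this
          linarith [le_abs_self (c (x, (S x).2) - c (S x))]
      _ = (∫ z, c z ∂π) + ε := by
          rw [integral_add (hint S hS) (integrable_const ε), hcost]
          simp

lemma mongeITCost_le_kantorovichITCost {c : X × Y → ℝ} (hc : Continuous c) (w : ℝ≥0)
    (P : Measure X) [NullSingletonClass P] (Q : Measure Y) :
    mongeITCost c w P Q ≤ kantorovichITCost c w P Q := by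
  refine le_iInf₂ fun π hπ => ?_
  obtain ⟨_, rfl, hsnd⟩ := hπ
  refine EReal.le_of_forall_lt_iff_le.1 fun r hr => ?_
  have hr' := EReal.coe_lt_coe_iff.1 hr
  obtain ⟨T, hT, hTπ, hle⟩ := exists_measurable_map_eq_snd_integral_le hc π (sub_pos.2 hr')
  refine (iInf₂_le T ⟨hT, hTπ.trans_le hsnd⟩).trans (EReal.coe_le_coe_iff.2 ?_)
  linarith

end Cost

theorem mainTheorem8 (D : ℕ) (X Y : Set (EuclideanSpace ℝ (Fin D)))
    (hX : IsCompact X) (hY : IsCompact Y)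
    (c : X × Y → ℝ) (hc : Continuous c)
    (P : Measure X) [IsProbabilityMeasure P] [NullSingletonClass P]
    (Q : Measure Y) [IsProbabilityMeasure Q]
    (w : ℝ≥0) (hw : 1 ≤ w) :
    mongeITCost c w P Q = kantorovichITCost c w P Q := by
  have := isCompact_iff_compactSpace.1 hX
  have := isCompact_iff_compactSpace.1 hY
  exact le_antisymm (mongeITCost_le_kantorovichITCost hc w P Q)
    (kantorovichITCost_le_mongeITCost hc w P Q)
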